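/- **Corollary 1.11.** Call a measure space $(X,\mathfrak B,\mu)$ *strictly localisable* if $X$ has a partition $X=\bigsqcup_{i\in I}X_i$ into sets $X_i\in\mathfrak B$ with $\mu(X_i)<\infty$ such that a set $A\subseteq X$ belongs to $\mathfrak B$ if and only if $A\cap X_i\in\mathfrak B$ for all $i$, in which case $\mu(A)=\sum_{i}\mu(A\cap X_i)$ (every $\sigma$-finite space is such). For a measurable, $\mu$-essentially bounded $p:X\to[1,\infty)$ and a measurable $f:X\to\mathbb R$ (up to equality a.e.) let $$\Theta_{p(\cdot)}(f)=\int_X|f(x)|^{p(x)}\,d\mu(x)\in[0,\infty]$$ be the modular functional. The *Nakano space* $L_{p(\cdot)}(X,\mathfrak B,\mu)$ is the Banach lattice of all (classes of) measurable $f$ with $\Theta_{p(\cdot)}(f)<\infty$, with the pointwise a.e. linear and lattice operations and the norm $$\|f\|=\inf\{c>0:\Theta_{p(\cdot)}(f/c)\le 1\};$$ for $f\neq 0$ this is the unique $c>0$ with $\Theta_{p(\cdot)}(f/c)=1$. Let $(X,\mathfrak B,\mu)$ and $(Y,\mathfrak C,\nu)$ be strictly localisable measure spaces, let $p:X\to[1,\infty)$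 and $q:Y\to[1,\infty)$ be measurable and essentially bounded, and put $N=L_{p(\cdot)}(X,\mathfrak B,\mu)$, $N'=L_{q(\cdot)}(Y,\mathfrak C,\nu)$, with modular functionals $\Theta=\Theta_{p(\cdot)}$ and $\Theta'=\Theta_{q(\cdot)}$. Assume $\dim N\ge 2$, and let $\theta:N\to N'$ be an embedding of Banach lattices, that is, a linear map that preserves the lattice operations $\vee,\wedge$ and satisfies $\|\theta f\|=\|f\|$ for all $f\in N$. Then $\theta$ respects the modular functional: $\Theta'(\theta f)=\Theta(f)$ for every $f\in N$. -/

import Mathlib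

open MeasureTheory
open scoped ENNReal

noncomputable section

namespace Nakano

/-- A measure is strictly localisable if the space has a partition into measurable sets of finite
measure such that a set is measurable as soon as its trace on every piece is, and the measure of a
measurable set is the sum of the measures of its traces. -/
def StrictlyLocalisable {X : Type*} [MeasurableSpace X] (μ : Measure X) : Prop :=
  ∃ P : Set (Set X), P.PairwiseDisjoint id ∧ ⋃₀ P = Set.univ ∧
    (∀ s ∈ P, MeasurableSet s ∧ μ s < ∞) ∧
    (∀ A : Set X, MeasurableSet A ↔ ∀ s ∈ P, MeasurableSet (A ∩ s)) ∧
    (∀ A : Set X, MeasurableSet A → μ A = ∑' s : P, μ (A ∩ (s : Set X)))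

/-- An exponent function: measurable with values in `[1, ∞)` and essentially bounded. -/
structure IsExponent {X : Type*} [MeasurableSpace X] (μ : Measure X) (p : X → ℝ) : Prop where
  measurable : Measurable p
  one_le : ∀ x, 1 ≤ p x
  ess_bounded : ∃ r : ℝ, ∀ᵐ x ∂μ, p x ≤ r

/-- The modular functional `Θ(f) = ∫ |f(x)| ^ p(x) dμ` with values in `[0, ∞]`, on the space
`X →ₘ[μ] ℝ` of all measurable real functions up to equality almost everywhere. -/
def modular {X : Type*} [MeasurableSpace X] (μ : Measure X) (p : X → ℝ) (f : X →ₘ[μ] ℝ) : ℝ≥0∞ :=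
  ∫⁻ x, ENNReal.ofReal (|f x| ^ p x) ∂μ

section basic

variable {X : Type*} [MeasurableSpace X] {μ : Measure X} {p : X → ℝ}

lemma modular_zero (hp : IsExponent μ p) : modular μ p 0 = 0 := by
  unfold modular
  rw [lintegral_congr_ae (g := fun _ => 0)]
  · simp
  filter_upwards [AEEqFun.coeFn_zero (α := X) (μ := μ) (β := ℝ)] with x hx
  have h := hp.one_le x
  simp [hx, Real.zero_rpow (show p x ≠ 0 by linarith)]

lemma modular_mono (hp : IsExponent μ p) {f g : X →ₘ[μ] ℝ} (h : ∀ᵐ x ∂μ, |f x| ≤ |g x|) :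
    modular μ p f ≤ modular μ p g := by
  refine lintegral_mono_ae ?_
  filter_upwards [h] with x hx
  exact ENNReal.ofReal_le_ofReal
    (Real.rpow_le_rpow (abs_nonneg _) hx (by linarith [hp.one_le x]))

lemma modular_smul_le {r : ℝ} (hp : IsExponent μ p) (hr : ∀ᵐ x ∂μ, p x ≤ r) {a c : ℝ}
    (ha : 1 ≤ a) (hc : |c| ≤ a) (f : X →ₘ[μ] ℝ) :
    modular μ p (c • f) ≤ ENNReal.ofReal (a ^ r) * modular μ p f := by
  unfold modular
  rw [← lintegral_const_mul' _ _ ENNReal.ofReal_ne_top]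
  refine lintegral_mono_ae ?_
  filter_upwards [AEEqFun.coeFn_smul c f, hr] with x hx hrx
  have h1 := hp.one_le x
  rw [hx, ← ENNReal.ofReal_mul (by positivity)]
  refine ENNReal.ofReal_le_ofReal ?_
  rw [Pi.smul_apply, smul_eq_mul, abs_mul, Real.mul_rpow (abs_nonneg _) (abs_nonneg _)]
  gcongr
  calc |c| ^ p x ≤ a ^ p x := Real.rpow_le_rpow (abs_nonneg _) hc (by linarith)
    _ ≤ a ^ r := Real.rpow_le_rpow_of_exponent_le ha hrx

lemma mul_modular_le (hp : IsExponent μ p) {a : ℝ} (ha : 1 ≤ a) (f : X →ₘ[μ] ℝ) :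
    ENNReal.ofReal a * modular μ p f ≤ modular μ p (a • f) := by
  unfold modular
  rw [← lintegral_const_mul' _ _ ENNReal.ofReal_ne_top]
  refine lintegral_mono_ae ?_
  filter_upwards [AEEqFun.coeFn_smul a f] with x hx
  have h1 := hp.one_le x
  rw [hx, ← ENNReal.ofReal_mul (by positivity)]
  refine ENNReal.ofReal_le_ofReal ?_
  rw [Pi.smul_apply, smul_eq_mul, abs_mul, Real.mul_rpow (abs_nonneg _) (abs_nonneg _),
    abs_of_nonneg (by linarith : 0 ≤ a)]
  gcongr
  exact Real.self_le_rpow_of_one_le ha h1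

lemma modular_le_add (hp : IsExponent μ p) {f g h : X →ₘ[μ] ℝ}
    (hh : ∀ᵐ x ∂μ, |h x| ≤ max |f x| |g x|) :
    modular μ p h ≤ modular μ p f + modular μ p g := by
  unfold modular
  have hm : AEMeasurable (fun x => ENNReal.ofReal (|f x| ^ p x)) μ :=
    ((f.aemeasurable.norm).pow hp.measurable.aemeasurable).ennreal_ofReal
  rw [← lintegral_add_left' hm]
  refine lintegral_mono_ae ?_
  filter_upwards [hh] with x hx
  have h1 := hp.one_le x
  have h2 := ENNReal.ofReal_le_ofReal
    (Real.rpow_le_rpow (abs_nonneg _) hx (by linarith : 0 ≤ p x))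
  rcases max_choice |f x| |g x| with h3 | h3 <;> rw [h3] at h2
  · exact h2.trans le_self_add
  · exact h2.trans le_add_self

lemma modular_smul_lt_top (hp : IsExponent μ p) (c : ℝ) {f : X →ₘ[μ] ℝ}
    (hf : modular μ p f < ∞) : modular μ p (c • f) < ∞ := by
  obtain ⟨r, hr⟩ := hp.ess_bounded
  exact (modular_smul_le hp hr (le_max_right |c| 1) (le_max_left _ _) f).trans_lt
    (ENNReal.mul_lt_top ENNReal.ofReal_lt_top hf)

end basic

/-- The Nakano space of all `f` with `Θ(f) < ∞`, as a linear subspace of the space of measurable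
functions up to equality almost everywhere. -/
def NakanoSpace {X : Type*} [MeasurableSpace X] (μ : Measure X) (p : X → ℝ)
    (hp : IsExponent μ p) : Submodule ℝ (X →ₘ[μ] ℝ) where
  carrier := {f | modular μ p f < ∞}
  zero_mem' := by simp [modular_zero hp]
  add_mem' := by
    intro f g hf hg
    refine (modular_le_add hp (f := (2 : ℝ) • f) (g := (2 : ℝ) • g) ?_).trans_lt
      (ENNReal.add_lt_top.2 ⟨modular_smul_lt_top hp 2 hf, modular_smul_lt_top hp 2 hg⟩)
    filter_upwards [AEEqFun.coeFn_add f g, AEEqFun.coeFn_smul (2 : ℝ) f,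
      AEEqFun.coeFn_smul (2 : ℝ) g] with x h1 h2 h3
    rw [h1, h2, h3]
    simp only [Pi.add_apply, Pi.smul_apply, smul_eq_mul, abs_mul, abs_two]
    have := abs_add_le (f x) (g x)
    rcases le_total |f x| |g x| with h | h
    · exact le_max_of_le_right (by linarith)
    · exact le_max_of_le_left (by linarith)
  smul_mem' := fun c _ hf => modular_smul_lt_top hp c hf

section structures

variable {X : Type*} [MeasurableSpace X] {μ : Measure X} {p : X → ℝ} {hp : IsExponent μ p}

/-- The Nakano space is a lattice under the almost everywhere pointwise order, with the pointwise
maximum and minimum as lattice operations. -/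
instance : Lattice (NakanoSpace μ p hp) :=
  Subtype.lattice
    (fun {f g} hf hg => (modular_le_add hp (h := f ⊔ g) (by
      filter_upwards [AEEqFun.coeFn_sup f g] with x hx
      rw [hx]
      exact abs_max_le_max_abs_abs)).trans_lt (ENNReal.add_lt_top.2 ⟨hf, hg⟩))
    (fun {f g} hf hg => (modular_le_add hp (h := f ⊓ g) (by
      filter_upwards [AEEqFun.coeFn_inf f g] with x hx
      rw [hx]
      exact abs_min_le_max_abs_abs)).trans_lt (ENNReal.add_lt_top.2 ⟨hf, hg⟩))

/-- The norm of a Nakano space: `‖f‖` is the infimum of all `c > 0` with `Θ(f / c) ≤ 1`.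
For `f ≠ 0` it is the unique `c > 0` with `Θ(f / c) = 1`, see `modular_inv_smul_eq_one_iff`. -/
instance : Norm (NakanoSpace μ p hp) :=
  ⟨fun f => sInf {c : ℝ | 0 < c ∧ modular μ p (c⁻¹ • (f : X →ₘ[μ] ℝ)) ≤ 1}⟩

lemma norm_def (f : NakanoSpace μ p hp) :
    ‖f‖ = sInf {c : ℝ | 0 < c ∧ modular μ p (c⁻¹ • (f : X →ₘ[μ] ℝ)) ≤ 1} := rfl

lemma norm_zero_eq : ‖(0 : NakanoSpace μ p hp)‖ = 0 := by
  have : {c : ℝ | 0 < c ∧ modular μ p (c⁻¹ • ((0 : NakanoSpace μ p hp) : X →ₘ[μ] ℝ)) ≤ 1}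
      = Set.Ioi 0 := by
    ext c
    simp [modular_zero hp]
  rw [norm_def, this, csInf_Ioi]

lemma ratio_mul_modular_le {c d : ℝ} (hc : 0 < c) (hcd : c ≤ d) (hp : IsExponent μ p)
    (f : X →ₘ[μ] ℝ) :
    ENNReal.ofReal (d / c) * modular μ p (d⁻¹ • f) ≤ modular μ p (c⁻¹ • f) := by
  have hd : 0 < d := hc.trans_le hcd
  have h := mul_modular_le hp ((one_le_div hc).2 hcd) (d⁻¹ • f)
  rwa [smul_smul, show d / c * d⁻¹ = c⁻¹ by field_simp] at h

lemma exists_modular_inv_smul_le_one (f : NakanoSpace μ p hp) :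
    ∃ c : ℝ, 0 < c ∧ modular μ p (c⁻¹ • (f : X →ₘ[μ] ℝ)) ≤ 1 := by
  have hf : modular μ p (f : X →ₘ[μ] ℝ) < ∞ := f.2
  set M := (modular μ p (f : X →ₘ[μ] ℝ)).toReal with hM
  have hM0 : 0 ≤ M := ENNReal.toReal_nonneg
  refine ⟨M + 1, by positivity, ?_⟩
  have h := ratio_mul_modular_le one_pos (by linarith : (1 : ℝ) ≤ M + 1) hp (f : X →ₘ[μ] ℝ)
  rw [inv_one, one_smul, div_one] at h
  by_contra! hlt
  have h1 : ENNReal.ofReal (M + 1) ≤ ENNReal.ofReal M := by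
    calc ENNReal.ofReal (M + 1) = ENNReal.ofReal (M + 1) * 1 := (mul_one _).symm
      _ ≤ _ := mul_le_mul_right hlt.le _
      _ ≤ modular μ p (f : X →ₘ[μ] ℝ) := h
      _ = ENNReal.ofReal M := (ENNReal.ofReal_toReal hf.ne).symm
  rw [ENNReal.ofReal_le_ofReal_iff hM0] at h1
  linarith

lemma modular_eq_zero {f : X →ₘ[μ] ℝ} (hp : IsExponent μ p) (h : modular μ p f = 0) : f = 0 := by
  have hm : AEMeasurable (fun x => ENNReal.ofReal (|f x| ^ p x)) μ :=
    ((f.aemeasurable.norm).pow hp.measurable.aemeasurable).ennreal_ofReal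
  have h0 := (lintegral_eq_zero_iff' hm).1 h
  refine AEEqFun.ext ?_
  filter_upwards [h0, AEEqFun.coeFn_zero (α := X) (μ := μ) (β := ℝ)] with x hx h2
  rw [h2]
  have h3 : |f x| ^ p x ≤ 0 := ENNReal.ofReal_eq_zero.1 hx
  by_contra hne
  exact absurd h3 (not_le.2 (Real.rpow_pos_of_pos (abs_pos.2 hne) _))

/-- The norm of a nonzero `f` is the unique `c > 0` with `Θ(f / c) = 1`. -/
theorem modular_inv_smul_eq_one_iff (f : NakanoSpace μ p hp) (hf : f ≠ 0) (c : ℝ) :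
    (0 < c ∧ modular μ p (c⁻¹ • (f : X →ₘ[μ] ℝ)) = 1) ↔ c = ‖f‖ := by
  obtain ⟨r, hr⟩ := hp.ess_bounded
  set S := {c : ℝ | 0 < c ∧ modular μ p (c⁻¹ • (f : X →ₘ[μ] ℝ)) ≤ 1} with hS
  have hbdd : BddBelow S := ⟨0, fun _ h => h.1.le⟩
  have hne : S.Nonempty := exists_modular_inv_smul_le_one f
  have hup : ∀ {a b : ℝ}, a ∈ S → a ≤ b → b ∈ S := by
    intro a b ha hab
    refine ⟨ha.1.trans_le hab, (modular_mono hp ?_).trans ha.2⟩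
    filter_upwards [AEEqFun.coeFn_smul a⁻¹ (f : X →ₘ[μ] ℝ),
      AEEqFun.coeFn_smul b⁻¹ (f : X →ₘ[μ] ℝ)] with x h1 h2
    have ha0 := ha.1
    have hb0 := ha0.trans_le hab
    rw [h1, h2]
    simp only [Pi.smul_apply, smul_eq_mul, abs_mul, abs_inv, abs_of_pos ha0, abs_of_pos hb0]
    gcongr
  have hmem : ∀ {d : ℝ}, sInf S < d → d ∈ S := by
    intro d hd
    obtain ⟨a, ha, had⟩ := exists_lt_of_csInf_lt hne hd
    exact hup ha had.le
  have hpos : 0 < sInf S := by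
    refine lt_of_le_of_ne (le_csInf hne fun _ h => h.1.le) fun h0 => hf ?_
    refine Subtype.ext (modular_eq_zero hp ?_)
    refine le_antisymm (ENNReal.le_of_forall_pos_le_add fun ε hε _ => ?_) zero_le
    rw [zero_add]
    set e : ℝ := min 1 (ε : ℝ) with he
    have he0 : 0 < e := lt_min one_pos (by exact_mod_cast hε)
    have hmem1 := (hmem (h0 ▸ he0 : sInf S < e)).2
    have h := ratio_mul_modular_le he0 (min_le_left _ _) hp (f : X →ₘ[μ] ℝ)
    rw [inv_one, one_smul] at h
    calc modular μ p (f : X →ₘ[μ] ℝ)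
        = ENNReal.ofReal e * (ENNReal.ofReal (1 / e) * modular μ p (f : X →ₘ[μ] ℝ)) := by
          rw [← mul_assoc, ← ENNReal.ofReal_mul he0.le, mul_one_div_cancel he0.ne']
          simp
      _ ≤ ENNReal.ofReal e * 1 := by gcongr; exact h.trans hmem1
      _ ≤ ε := by
          rw [mul_one]
          exact (ENNReal.ofReal_le_ofReal (min_le_right _ _)).trans (by simp)
  have hcont : Filter.Tendsto (fun t : ℝ => ENNReal.ofReal (t ^ r)) (nhdsWithin 1 (Set.Ioi 1))
      (nhds 1) := by
    have h1 : ContinuousAt (fun t : ℝ => ENNReal.ofReal (t ^ r)) 1 :=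
      ENNReal.continuous_ofReal.continuousAt.comp
        (Real.continuousAt_rpow_const 1 r (Or.inl one_ne_zero))
    have h2 := h1.tendsto
    simp only [Real.one_rpow, ENNReal.ofReal_one] at h2
    exact h2.mono_left nhdsWithin_le_nhds
  have hscale : ∀ {a b t : ℝ}, 0 < a → 1 < t → b = t * a →
      modular μ p (a⁻¹ • (f : X →ₘ[μ] ℝ))
        ≤ ENNReal.ofReal (t ^ r) * modular μ p (b⁻¹ • (f : X →ₘ[μ] ℝ)) := by
    intro a b t ha ht hb
    have h := modular_smul_le hp hr ht.le (abs_of_pos (one_pos.trans ht)).le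
      (b⁻¹ • (f : X →ₘ[μ] ℝ))
    rwa [smul_smul, show t * b⁻¹ = a⁻¹ by
      rw [hb]
      have : t ≠ 0 := (one_pos.trans ht).ne'
      field_simp] at h
  have hone : modular μ p ((sInf S)⁻¹ • (f : X →ₘ[μ] ℝ)) = 1 := by
    refine le_antisymm ?_ ?_
    · refine ge_of_tendsto hcont ?_
      filter_upwards [self_mem_nhdsWithin] with t ht
      have h1 : t * sInf S ∈ S := hmem (lt_mul_of_one_lt_left hpos ht)
      calc _ ≤ _ := hscale hpos ht rfl
        _ ≤ ENNReal.ofReal (t ^ r) * 1 := by gcongr; exact h1.2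
        _ = _ := mul_one _
    · have h2 := ENNReal.Tendsto.mul_const
        (b := modular μ p ((sInf S)⁻¹ • (f : X →ₘ[μ] ℝ))) hcont (Or.inl one_ne_zero)
      rw [one_mul] at h2
      refine ge_of_tendsto h2 ?_
      filter_upwards [self_mem_nhdsWithin] with t ht
      have ht0 : (0 : ℝ) < t := one_pos.trans ht
      have h1 : sInf S / t ∉ S := fun hmem' =>
        absurd (csInf_le hbdd hmem') (not_le.2 (div_lt_self hpos ht))
      have h3 : 1 < modular μ p ((sInf S / t)⁻¹ • (f : X →ₘ[μ] ℝ)) := by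
        by_contra! hle
        exact h1 ⟨div_pos hpos ht0, hle⟩
      exact h3.le.trans (hscale (div_pos hpos ht0) ht (by field_simp))
  rw [norm_def]
  constructor
  · rintro ⟨hc, h1⟩
    refine le_antisymm ?_ (csInf_le hbdd ⟨hc, h1.le⟩)
    have h := ratio_mul_modular_le hpos (csInf_le hbdd ⟨hc, h1.le⟩) hp (f : X →ₘ[μ] ℝ)
    rw [h1, hone, mul_one, ENNReal.ofReal_le_one, div_le_one hpos] at h
    exact h
  · rintro rfl
    exact ⟨hpos, hone⟩

end structures

/-- An (isometric) embedding of Banach lattices: a linear map that preserves the lattice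
operations and the norm. -/
structure LatticeEmbedding (E F : Type*) [AddCommGroup E] [Module ℝ E] [Lattice E] [Norm E]
    [AddCommGroup F] [Module ℝ F] [Lattice F] [Norm F] extends E →ₗ[ℝ] F where
  map_sup : ∀ f g : E, toFun (f ⊔ g) = toFun f ⊔ toFun g
  map_inf : ∀ f g : E, toFun (f ⊓ g) = toFun f ⊓ toFun g
  norm_map : ∀ f : E, ‖toFun f‖ = ‖f‖

end Nakano

end

/-! A lattice embedding `θ` preserves disjointness, and an isometry preserves the unit sphere, which
is `Θ = 1`. Since `Θ` is additive on disjoint elements, any disjoint elements whose levels add up to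
1 have images whose levels add up to 1.

Given three disjoint nonzero elements, this is Cauchy's functional equation on `[0, 1]`: `θ` keeps
every level at most 1 (`eq_self_of_add_add_eq_one`). Along a ray, `t ↦ Θ(exp t • f)` is the moment
generating function of the exponent under the measure `|f| ^ p dμ`, hence analytic, so agreement on
small multiples extends to all of the ray (`modular_eq_of_forall_expModular_le_one`).

If only two atoms are available, the exponent is a constant `a` resp. `b` on each, and the image
functions satisfy `H s + K t = 1` whenever `exp (a s) + exp (b t) = 1`. This alone does not
determine `H` and `K`, but they are moment generating functions of bounded exponents under
probability measures. Jensen's and Bernoulli's inequalities then leave only the exponentials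
(`eq_exp_of_add_eq_one`).

A non-atomic element splits into two disjoint pieces, which supplies the third element. If `f` is
disjoint from nothing nonzero, then `dim ≥ 2` prevents it from being atomic, and each of its two
pieces has the other as a disjoint companion. -/

namespace Nakano

/-! ### The modular along a ray as a moment generating function. -/

section exponential

open ProbabilityTheory

variable {X : Type*} [MeasurableSpace X] {μ : Measure X} {p : X → ℝ}

lemma aemeasurable_modular_integrand (hp : IsExponent μ p) (f : X →ₘ[μ] ℝ) :
    AEMeasurable (fun x => ENNReal.ofReal (|f x| ^ p x)) μ :=
  ((f.aemeasurable.norm).pow hp.measurable.aemeasurable).ennreal_ofReal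

/-- The modular functional along the ray through `f`, parametrised exponentially. -/
noncomputable def expModular (μ : Measure X) (p : X → ℝ) (f : X →ₘ[μ] ℝ) (t : ℝ) : ℝ :=
  (modular μ p (Real.exp t • f)).toReal

/-- The measure with density `|f| ^ p`. -/
noncomputable def modularMeasure (μ : Measure X) (p : X → ℝ) (f : X →ₘ[μ] ℝ) : Measure X :=
  μ.withDensity fun x => ENNReal.ofReal (|f x| ^ p x)

lemma isFiniteMeasure_modularMeasure {f : X →ₘ[μ] ℝ} (hf : modular μ p f < ∞) :
    IsFiniteMeasure (modularMeasure μ p f) :=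
  isFiniteMeasure_withDensity hf.ne

lemma integrable_exp_mul_exponent (hp : IsExponent μ p) {f : X →ₘ[μ] ℝ}
    (hf : modular μ p f < ∞) (t : ℝ) :
    Integrable (fun x => Real.exp (t * p x)) (modularMeasure μ p f) := by
  have := isFiniteMeasure_modularMeasure hf
  obtain ⟨r, hr⟩ := hp.ess_bounded
  refine integrable_exp_mul_of_mem_Icc (a := 1) (b := r) hp.measurable.aemeasurable ?_
  filter_upwards [(withDensity_absolutelyContinuous μ _).ae_le hr] with x hx
  exact ⟨hp.one_le x, hx⟩

/-- Because `|exp t * f| ^ p = exp (t * p) * |f| ^ p`, the exponent `p` plays the role of the random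
variable. -/
lemma expModular_eq_mgf (hp : IsExponent μ p) (f : X →ₘ[μ] ℝ) (t : ℝ) :
    expModular μ p f t = mgf p (modularMeasure μ p f) t := by
  have hm : Measurable fun x => Real.exp (t * p x) :=
    Real.measurable_exp.comp (hp.measurable.const_mul t)
  rw [mgf, integral_eq_lintegral_of_nonneg_ae (Filter.Eventually.of_forall fun x =>
    (Real.exp_pos _).le) hm.aestronglyMeasurable, modularMeasure,
    lintegral_withDensity_eq_lintegral_mul₀ (aemeasurable_modular_integrand hp f)
      hm.ennreal_ofReal.aemeasurable, expModular, modular]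
  congr 1
  refine lintegral_congr_ae ?_
  filter_upwards [AEEqFun.coeFn_smul (Real.exp t) f] with x hx
  rw [hx, Pi.smul_apply, smul_eq_mul, abs_mul, Real.abs_exp,
    Real.mul_rpow (Real.exp_pos _).le (abs_nonneg _), ← Real.exp_mul, Pi.mul_apply,
    ← ENNReal.ofReal_mul (by positivity), mul_comm]

lemma analyticOnNhd_expModular (hp : IsExponent μ p) {f : X →ₘ[μ] ℝ} (hf : modular μ p f < ∞) :
    AnalyticOnNhd ℝ (expModular μ p f) Set.univ := by
  have h1 : integrableExpSet p (modularMeasure μ p f) = Set.univ :=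
    Set.eq_univ_of_forall fun t => integrable_exp_mul_exponent hp hf t
  have h2 := analyticOnNhd_mgf (X := p) (μ := modularMeasure μ p f)
  rw [h1, interior_univ] at h2
  rwa [funext (expModular_eq_mgf hp f)]

lemma continuous_expModular (hp : IsExponent μ p) {f : X →ₘ[μ] ℝ} (hf : modular μ p f < ∞) :
    Continuous (expModular μ p f) :=
  continuousOn_univ.1 (analyticOnNhd_expModular hp hf).continuousOn

lemma expModular_zero (f : X →ₘ[μ] ℝ) : expModular μ p f 0 = (modular μ p f).toReal := by
  simp [expModular]

lemma expModular_nonneg (f : X →ₘ[μ] ℝ) (t : ℝ) : 0 ≤ expModular μ p f t :=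
  ENNReal.toReal_nonneg

lemma exp_mul_expModular_le (hp : IsExponent μ p) {f : X →ₘ[μ] ℝ} (hf : modular μ p f < ∞)
    {s t : ℝ} (hst : s ≤ t) :
    Real.exp (t - s) * expModular μ p f s ≤ expModular μ p f t := by
  have h := mul_modular_le hp (Real.one_le_exp (sub_nonneg.2 hst)) (Real.exp s • f)
  rw [smul_smul, ← Real.exp_add, sub_add_cancel] at h
  have h2 := ENNReal.toReal_mono (modular_smul_lt_top hp _ hf).ne h
  rwa [ENNReal.toReal_mul, ENNReal.toReal_ofReal (Real.exp_pos _).le] at h2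

lemma exists_expModular_eq (hp : IsExponent μ p) {f : X →ₘ[μ] ℝ} (hf : modular μ p f < ∞)
    (h0 : f ≠ 0) {a : ℝ} (ha : 0 < a) : ∃ t, expModular μ p f t = a := by
  have hpos : 0 < expModular μ p f 0 := by
    rw [expModular_zero]
    exact ENNReal.toReal_pos (fun h => h0 (modular_eq_zero hp h)) hf.ne
  set e := expModular μ p f 0 with he
  -- Intermediate values: since `p ≥ 1`, moving from `0` by `log (a / e)` in its own direction
  -- overshoots the level `a`. The `min` and `max` with `0` make the growth estimate applicable for
  -- either sign.
  refine mem_range_of_exists_le_of_exists_ge (continuous_expModular hp hf)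
    ⟨min 0 (Real.log (a / e)), ?_⟩ ⟨max 0 (Real.log (a / e)), ?_⟩
  · have h := exp_mul_expModular_le hp hf (min_le_left 0 (Real.log (a / e)))
    have h3 : expModular μ p f (min 0 (Real.log (a / e)))
        ≤ Real.exp (min 0 (Real.log (a / e))) * e := by
      rw [zero_sub, Real.exp_neg, inv_mul_le_iff₀ (Real.exp_pos _)] at h
      exact h
    calc _ ≤ _ := h3
      _ ≤ Real.exp (Real.log (a / e)) * e := by gcongr; exact min_le_right _ _
      _ = a := by rw [Real.exp_log (by positivity)]; field_simp
  · have h := exp_mul_expModular_le hp hf (le_max_left 0 (Real.log (a / e)))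
    refine le_trans ?_ h
    calc a = Real.exp (Real.log (a / e)) * e := by
          rw [Real.exp_log (by positivity)]; field_simp
      _ ≤ _ := by gcongr; rw [sub_zero]; exact le_max_right _ _

lemma expModular_strictMono (hp : IsExponent μ p) {f : X →ₘ[μ] ℝ} (hf : modular μ p f < ∞)
    (h0 : f ≠ 0) : StrictMono (expModular μ p f) := by
  intro s t hst
  refine lt_of_lt_of_le ?_ (exp_mul_expModular_le hp hf hst.le)
  have hpos : 0 < expModular μ p f s := ENNReal.toReal_pos
    (fun h => h0 (((smul_eq_zero_iff_right (Real.exp_pos s).ne').1 (modular_eq_zero hp h))))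
    (modular_smul_lt_top hp _ hf).ne
  exact lt_mul_of_one_lt_left hpos (Real.one_lt_exp_iff.2 (sub_pos.2 hst))

/-- Two modular functionals that agree on the small multiples of an element agree on the element
itself, by analyticity. -/
lemma modular_eq_of_forall_expModular_le_one {Y : Type*} [MeasurableSpace Y] {ν : Measure Y}
    {q : Y → ℝ} (hp : IsExponent μ p) (hq : IsExponent ν q) {f : X →ₘ[μ] ℝ} {g : Y →ₘ[ν] ℝ}
    (hf : modular μ p f < ∞) (hg : modular ν q g < ∞) (h0 : f ≠ 0)
    (h : ∀ t, expModular μ p f t ≤ 1 → expModular ν q g t = expModular μ p f t) :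
    modular μ p f = modular ν q g := by
  obtain ⟨c, hc⟩ := exists_expModular_eq hp hf h0 one_pos
  -- Any point below `c` has a neighbourhood on which the level stays at most 1; `c - 1` is one such
  -- point for the identity theorem.
  have hev : expModular μ p f =ᶠ[nhds (c - 1)] expModular ν q g := by
    filter_upwards [Iio_mem_nhds (sub_one_lt c)] with t ht
    exact (h t (hc ▸ (expModular_strictMono hp hf h0).monotone (le_of_lt ht))).symm
  have h1 := (analyticOnNhd_expModular hp hf).eqOn_of_preconnected_of_eventuallyEq
    (analyticOnNhd_expModular hq hg) isPreconnected_univ (Set.mem_univ _) hev (Set.mem_univ 0)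
  rw [expModular_zero, expModular_zero] at h1
  exact (ENNReal.toReal_eq_toReal_iff' hf.ne hg.ne).1 h1

/-- `Θ(f) = 1` makes `|f| ^ p dμ` a probability measure, and the variance of `exp (t * p)` is
nonnegative. -/
lemma sq_expModular_le (hp : IsExponent μ p) {f : X →ₘ[μ] ℝ} (hf : modular μ p f = 1) (t : ℝ) :
    expModular μ p f t ^ 2 ≤ expModular μ p f (2 * t) := by
  have hf' : modular μ p f < ∞ := by simp [hf]
  have hi := integrable_exp_mul_exponent hp hf'
  have hfin := isFiniteMeasure_modularMeasure hf'
  have h1 : (modularMeasure μ p f).real Set.univ = 1 := by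
    have := expModular_eq_mgf hp f 0
    rw [expModular_zero, hf, mgf_zero'] at this
    simpa using this.symm
  set c := expModular μ p f t with hc
  have h2 : ∫ x, (2 * c * Real.exp (t * p x)) ∂(modularMeasure μ p f)
      ≤ ∫ x, (Real.exp (2 * t * p x) + c ^ 2) ∂(modularMeasure μ p f) := by
    refine integral_mono ((hi t).const_mul _) ((hi (2 * t)).add (integrable_const _)) fun x => ?_
    have h3 : Real.exp (2 * t * p x) = Real.exp (t * p x) ^ 2 := by
      rw [← Real.exp_nat_mul]; congr 1; push_cast; ring
    simp only [h3]
    nlinarith [sq_nonneg (Real.exp (t * p x) - c)]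
  rw [integral_const_mul, integral_add (hi (2 * t)) (integrable_const _), integral_const, h1,
    one_smul] at h2
  have h4 := expModular_eq_mgf hp f t
  have h5 := expModular_eq_mgf hp f (2 * t)
  rw [mgf] at h4 h5
  rw [← h4, ← h5] at h2
  nlinarith

/-- For `s ≤ 0`, `exp (s * p) ≥ exp (c * s) ^ R`, and Bernoulli's inequality bounds the latter
below; integrate against a probability measure. -/
lemma one_sub_mul_le_expModular (hp : IsExponent μ p) {f : X →ₘ[μ] ℝ} (hf : modular μ p f = 1)
    {c R s : ℝ} (hR : 1 ≤ R) (hpR : ∀ᵐ x ∂μ, p x ≤ R * c) (hs : s ≤ 0) :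
    1 - R * (1 - Real.exp (c * s)) ≤ expModular μ p f s := by
  have hf' : modular μ p f < ∞ := by simp [hf]
  have hi := integrable_exp_mul_exponent hp hf'
  have hfin := isFiniteMeasure_modularMeasure hf'
  have h1 : (modularMeasure μ p f).real Set.univ = 1 := by
    have := expModular_eq_mgf hp f 0
    rw [expModular_zero, hf, mgf_zero'] at this
    simpa using this.symm
  have h2 : ∫ _, (1 - R * (1 - Real.exp (c * s))) ∂(modularMeasure μ p f)
      ≤ ∫ x, Real.exp (s * p x) ∂(modularMeasure μ p f) := by
    refine integral_mono_ae (integrable_const _) (hi s) ?_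
    filter_upwards [(withDensity_absolutelyContinuous μ _).ae_le hpR] with x hx
    have h3 := one_add_mul_self_le_rpow_one_add (s := Real.exp (c * s) - 1)
      (by linarith [Real.exp_pos (c * s)]) hR
    rw [add_sub_cancel, ← Real.exp_mul] at h3
    have h4 : Real.exp (c * s * R) ≤ Real.exp (s * p x) := by
      apply Real.exp_le_exp.2; nlinarith
    linarith
  rw [integral_const, h1, one_smul] at h2
  have h4 := expModular_eq_mgf hp f s
  rw [mgf] at h4
  rwa [h4]

end exponential

/-! ### Functional equations on the real line. -/

lemma le_one_of_forall_pow_two_pow_le {x R : ℝ} (h : ∀ n : ℕ, x ^ 2 ^ n ≤ R) : x ≤ 1 := by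
  by_contra! hx
  obtain ⟨n, hn⟩ := pow_unbounded_of_one_lt R hx
  exact absurd (h n) (not_le.2 (hn.trans_le (pow_le_pow_right₀ hx.le n.lt_two_pow_self.le)))

/-- Power trick: repeated squaring bounds all the powers `(K t / exp (b * t)) ^ 2 ^ n` by the same
`R`, so the constant can be dropped. -/
lemma le_exp_of_sq_le {K : ℝ → ℝ} {b R : ℝ} (h0 : ∀ t, 0 ≤ K t) (hsq : ∀ t, K t ^ 2 ≤ K (2 * t))
    (hR : ∀ t < 0, K t ≤ R * Real.exp (b * t)) {t : ℝ} (ht : t < 0) : K t ≤ Real.exp (b * t) := by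
  have hpow : ∀ n : ℕ, K t ^ 2 ^ n ≤ K (2 ^ n * t) := by
    intro n
    induction n with
    | zero => simp
    | succ n ih =>
      calc K t ^ 2 ^ (n + 1) = (K t ^ 2 ^ n) ^ 2 := by rw [← pow_mul, pow_succ]
        _ ≤ K (2 ^ n * t) ^ 2 := by have := h0 t; gcongr
        _ ≤ K (2 ^ (n + 1) * t) := (hsq _).trans_eq (by rw [← mul_assoc, ← pow_succ'])
  have h1 : K t / Real.exp (b * t) ≤ 1 := by
    refine le_one_of_forall_pow_two_pow_le (R := R) fun n => ?_
    rw [div_pow, div_le_iff₀ (by positivity), ← Real.exp_nat_mul]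
    refine (hpow n).trans ((hR _ (by nlinarith [pow_pos (two_pos (α := ℝ)) n])).trans_eq ?_)
    congr 2
    push_cast
    ring
  rwa [div_le_one (Real.exp_pos _)] at h1

/-- Two functions on the negative half-line that behave like mixtures of exponentials and satisfy
`H s + K t = 1` whenever `exp (a s) + exp (b t) = 1` are themselves exponentials. -/
lemma eq_exp_of_add_eq_one {H K : ℝ → ℝ} {a b R : ℝ} (ha : 0 < a) (hb : 0 < b)
    (hH0 : ∀ t, 0 ≤ H t) (hK0 : ∀ t, 0 ≤ K t)
    (hHsq : ∀ t, H t ^ 2 ≤ H (2 * t)) (hKsq : ∀ t, K t ^ 2 ≤ K (2 * t))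
    (hH : ∀ s ≤ 0, 1 - R * (1 - Real.exp (a * s)) ≤ H s)
    (hK : ∀ s ≤ 0, 1 - R * (1 - Real.exp (b * s)) ≤ K s)
    (hHK : ∀ s t, Real.exp (a * s) + Real.exp (b * t) = 1 → H s + K t = 1) {s : ℝ} (hs : s < 0) :
    H s = Real.exp (a * s) := by
  have key : ∀ {a b : ℝ}, 0 < a → 0 < b → ∀ t < 0, ∃ s < 0,
      Real.exp (a * s) + Real.exp (b * t) = 1 := by
    intro a b ha hb t ht
    have h1 : Real.exp (b * t) < 1 := by rw [Real.exp_lt_one_iff]; nlinarith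
    refine ⟨Real.log (1 - Real.exp (b * t)) / a, ?_, ?_⟩
    · exact div_neg_of_neg_of_pos
        (Real.log_neg (by linarith) (by linarith [Real.exp_pos (b * t)])) ha
    · rw [mul_div_cancel₀ _ ha.ne', Real.exp_log (by linarith)]
      ring
  have hKle : ∀ t < 0, K t ≤ Real.exp (b * t) := fun t ht =>
    le_exp_of_sq_le (R := R) hK0 hKsq (fun t ht => by
      -- At the companion point `s`, the lower bound for `H` reads `1 - R * exp (b * t) ≤ H s`, so
      -- `K t = 1 - H s` is at most `R * exp (b * t)`.
      obtain ⟨s, hs, hst⟩ := key ha hb t ht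
      have h1 := hH s hs.le
      have h2 := hHK s t hst
      rw [← hst] at h1
      nlinarith) ht
  have hHle : ∀ t < 0, H t ≤ Real.exp (a * t) := fun t ht =>
    le_exp_of_sq_le (R := R) hH0 hHsq (fun t ht => by
      obtain ⟨s, hs, hst⟩ := key hb ha t ht
      have h1 := hK s hs.le
      have h2 := hHK t s (by linarith)
      rw [← hst] at h1
      nlinarith) ht
  -- The two upper bounds add up to 1, as do the values `H s` and `K t`; hence both are equalities.
  obtain ⟨t, ht, hst⟩ := key hb ha s hs
  have h1 := hHK s t (by linarith)
  linarith [hHle s hs, hKle t ht]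

/-- Three nonnegative functions with `f a + g b + h c = 1` whenever `a + b + c = 1` are the
identity on `[0, 1]`. -/
lemma eq_self_of_add_add_eq_one {f g h : ℝ → ℝ} (hf0 : f 0 = 0) (hg0 : g 0 = 0) (hh0 : h 0 = 0)
    (hf : ∀ a, 0 ≤ f a)
    (H : ∀ a b c, 0 ≤ a → 0 ≤ b → 0 ≤ c → a + b + c = 1 → f a + g b + h c = 1)
    {a : ℝ} (ha : 0 ≤ a) (ha1 : a ≤ 1) : f a = a := by
  have hf1 : f 1 = 1 := by
    have := H 1 0 0 zero_le_one le_rfl le_rfl (by norm_num)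
    rwa [hg0, hh0, add_zero, add_zero] at this
  -- With the third slot fixed, mass `b` can be moved from `g` to `f`; the last two instances give
  -- `g b = f b`.
  have hadd : ∀ a b, 0 ≤ a → 0 ≤ b → a + b ≤ 1 → f (a + b) = f a + f b := by
    intro a b ha hb hab
    have h1 := H a b (1 - a - b) ha hb (by linarith) (by ring)
    have h2 := H (a + b) 0 (1 - a - b) (by linarith) le_rfl (by linarith) (by ring)
    have h3 := H b 0 (1 - b) hb le_rfl (by linarith) (by ring)
    have h4 := H 0 b (1 - b) le_rfl hb (by linarith) (by ring)
    linarith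
  have hmul : ∀ x : ℝ, 0 ≤ x → ∀ k : ℕ, k * x ≤ 1 → f (k * x) = k * f x := by
    intro x hx k
    induction k with
    | zero => intro _; simp [hf0]
    | succ k ih =>
      intro hk
      push_cast at hk ⊢
      rw [add_mul, one_mul] at hk ⊢
      rw [hadd _ _ (by positivity) hx hk, ih (by linarith)]
      ring
  have hle : ∀ a, 0 ≤ a → a ≤ 1 → a ≤ f a := by
    intro a ha ha1
    refine le_of_forall_pos_le_add fun ε hε => ?_
    obtain ⟨n, hn⟩ := exists_nat_one_div_lt hε
    have hn0 : (0 : ℝ) < n + 1 := by positivity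
    set x : ℝ := 1 / (n + 1) with hx
    have hx0 : 0 < x := by positivity
    have hnx : ((n + 1 : ℕ) : ℝ) * x = 1 := by push_cast; rw [hx]; field_simp
    have hfx : f x = x := by
      have := hmul x hx0.le (n + 1) hnx.le
      rw [hnx, hf1] at this
      have h5 : ((n + 1 : ℕ) : ℝ) * (f x - x) = 0 := by rw [mul_sub, ← this, hnx, sub_self]
      rcases mul_eq_zero.1 h5 with h6 | h6
      · push_cast at h6; linarith
      · linarith
    -- Round `a` down to a multiple of `x`, where `f` is known; the remainder contributes a
    -- nonnegative value, and the rounding loses less than `x < ε`.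
    set k := ⌊a / x⌋₊ with hk
    have h1 : k * x ≤ a := (le_div_iff₀ hx0).1 (Nat.floor_le (by positivity))
    have h2 : a < (k + 1) * x := (div_lt_iff₀ hx0).1 (Nat.lt_floor_add_one _)
    have h3 := hmul x hx0.le k (h1.trans ha1)
    have h4 := hadd (k * x) (a - k * x) (by positivity) (by linarith) (by linarith)
    rw [add_sub_cancel, h3, hfx] at h4
    linarith [hf (a - k * x)]
  have h1 := hle a ha ha1
  have h2 := hle (1 - a) (by linarith) (by linarith)
  have h3 := hadd a (1 - a) ha (by linarith) (by linarith)
  rw [add_sub_cancel, hf1] at h3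
  linarith

/-! ### Disjoint elements and their images. -/

section disjoint

variable {X Y : Type*} [MeasurableSpace X] [MeasurableSpace Y] {μ : Measure X} {ν : Measure Y}
  {p : X → ℝ} {q : Y → ℝ}

/-- Two measurable functions are disjoint if almost everywhere one of them vanishes. -/
def Disj (f g : X →ₘ[μ] ℝ) : Prop := ∀ᵐ x ∂μ, f x = 0 ∨ g x = 0

lemma Disj.symm {f g : X →ₘ[μ] ℝ} (h : Disj f g) : Disj g f := by
  filter_upwards [h] with x hx using hx.symm

lemma Disj.smul {f g : X →ₘ[μ] ℝ} (h : Disj f g) (s t : ℝ) : Disj (s • f) (t • g) := by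
  filter_upwards [h, AEEqFun.coeFn_smul s f, AEEqFun.coeFn_smul t g] with x hx h1 h2
  rw [h1, h2]
  rcases hx with hx | hx <;> simp [hx]

lemma Disj.add {f g k : X →ₘ[μ] ℝ} (hf : Disj f k) (hg : Disj g k) : Disj (f + g) k := by
  filter_upwards [hf, hg, AEEqFun.coeFn_add f g] with x h1 h2 h3
  rw [h3, Pi.add_apply]
  rcases h1 with h1 | h1 <;> rcases h2 with h2 | h2 <;> simp [h1, h2]

lemma modular_add_of_disj (hp : IsExponent μ p) {f g : X →ₘ[μ] ℝ} (h : Disj f g) :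
    modular μ p (f + g) = modular μ p f + modular μ p g := by
  unfold modular
  rw [← lintegral_add_left' (aemeasurable_modular_integrand hp f)]
  refine lintegral_congr_ae ?_
  filter_upwards [h, AEEqFun.coeFn_add f g] with x hx h1
  have h2 : p x ≠ 0 := (zero_lt_one.trans_le (hp.one_le x)).ne'
  rw [h1, Pi.add_apply]
  rcases hx with hx | hx <;> simp [hx, Real.zero_rpow h2]

/-- Puts disjointness in purely lattice-linear terms, which an embedding transports. -/
lemma disj_iff_inf_eq_zero {f g : X →ₘ[μ] ℝ} : Disj f g ↔ (f ⊔ -f) ⊓ (g ⊔ -g) = 0 := by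
  have h : ((f ⊔ -f) ⊓ (g ⊔ -g) : X →ₘ[μ] ℝ) =ᵐ[μ] fun x => |f x| ⊓ |g x| := by
    filter_upwards [AEEqFun.coeFn_inf (f ⊔ -f) (g ⊔ -g), AEEqFun.coeFn_sup f (-f),
      AEEqFun.coeFn_sup g (-g), AEEqFun.coeFn_neg f, AEEqFun.coeFn_neg g] with x h1 h2 h3 h4 h5
    rw [h1, h2, h3, h4, h5]
    rfl
  have hiff : ∀ x, (f x = 0 ∨ g x = 0) ↔ |f x| ⊓ |g x| = 0 := by
    intro x
    rcases le_total |f x| |g x| with hx | hx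
    · rw [inf_eq_left.2 hx, abs_eq_zero]
      refine ⟨fun h => h.elim id fun h => ?_, Or.inl⟩
      rw [h, abs_zero] at hx
      exact abs_nonpos_iff.1 hx
    · rw [inf_eq_right.2 hx, abs_eq_zero]
      refine ⟨fun h => h.elim (fun h => ?_) id, Or.inr⟩
      rw [h, abs_zero] at hx
      exact abs_nonpos_iff.1 hx
  constructor
  · intro hd
    refine AEEqFun.ext ?_
    filter_upwards [hd, h, AEEqFun.coeFn_zero (α := X) (μ := μ) (β := ℝ)] with x h1 h2 h3
    rw [h2, h3, Pi.zero_apply]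
    exact (hiff x).1 h1
  · intro h0
    rw [h0] at h
    filter_upwards [h, AEEqFun.coeFn_zero (α := X) (μ := μ) (β := ℝ)] with x h2 h3
    rw [h3, Pi.zero_apply] at h2
    exact (hiff x).2 h2.symm

variable {hp : IsExponent μ p} {hq : IsExponent ν q}

lemma LatticeEmbedding.map_disj (θ : LatticeEmbedding (NakanoSpace μ p hp) (NakanoSpace ν q hq))
    {f g : NakanoSpace μ p hp} (h : Disj (f : X →ₘ[μ] ℝ) g) :
    Disj (θ.toLinearMap f : Y →ₘ[ν] ℝ) (θ.toLinearMap g) := by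
  rw [disj_iff_inf_eq_zero] at h ⊢
  have h1 : (f ⊔ -f) ⊓ (g ⊔ -g) = 0 := Subtype.ext h
  have h2 : θ.toLinearMap ((f ⊔ -f) ⊓ (g ⊔ -g)) = (θ.toLinearMap f ⊔ -θ.toLinearMap f) ⊓
      (θ.toLinearMap g ⊔ -θ.toLinearMap g) := by
    rw [← map_neg, ← map_neg]
    exact (θ.map_inf _ _).trans (congrArg₂ _ (θ.map_sup _ _) (θ.map_sup _ _))
  rw [h1, map_zero] at h2
  exact (congrArg Subtype.val h2).symm

lemma LatticeEmbedding.modular_map_add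
    (θ : LatticeEmbedding (NakanoSpace μ p hp) (NakanoSpace ν q hq))
    {f g : NakanoSpace μ p hp} (h : Disj (f : X →ₘ[μ] ℝ) g) :
    modular ν q (θ.toLinearMap (f + g)) =
      modular ν q (θ.toLinearMap f) + modular ν q (θ.toLinearMap g) := by
  rw [map_add, Submodule.coe_add]
  exact modular_add_of_disj hq (θ.map_disj h)

lemma modular_eq_one_iff (f : NakanoSpace μ p hp) : modular μ p f = 1 ↔ ‖f‖ = 1 := by
  by_cases hf : f = 0
  · subst hf
    simp [norm_zero_eq, modular_zero hp]
  · have := modular_inv_smul_eq_one_iff f hf 1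
    simpa [eq_comm] using this

lemma LatticeEmbedding.modular_map_eq_one
    (θ : LatticeEmbedding (NakanoSpace μ p hp) (NakanoSpace ν q hq))
    {f : NakanoSpace μ p hp} (h : modular μ p f = 1) : modular ν q (θ.toLinearMap f) = 1 := by
  rw [modular_eq_one_iff] at h ⊢
  exact (θ.norm_map f).trans h

lemma exists_smul_modular_eq {e : NakanoSpace μ p hp} (he : e ≠ 0) {a : ℝ} (ha : 0 ≤ a) :
    ∃ s : ℝ, modular μ p (s • e : NakanoSpace μ p hp) = ENNReal.ofReal a := by
  rcases ha.eq_or_lt with rfl | ha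
  · exact ⟨0, by simp [modular_zero hp]⟩
  · obtain ⟨t, ht⟩ := exists_expModular_eq hp e.2 (fun h => he (Subtype.ext h)) ha
    refine ⟨Real.exp t, ?_⟩
    rw [← ht, expModular, Submodule.coe_smul,
      ENNReal.ofReal_toReal (modular_smul_lt_top hp _ e.2).ne]

lemma LatticeEmbedding.expModular_map
    (θ : LatticeEmbedding (NakanoSpace μ p hp) (NakanoSpace ν q hq)) (f : NakanoSpace μ p hp)
    (t : ℝ) : expModular ν q (θ.toLinearMap f) t
      = (modular ν q (θ.toLinearMap (Real.exp t • f))).toReal := by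
  rw [map_smul, Submodule.coe_smul, expModular]

/-- An embedding respects the modular functional on an element that is disjoint from two further
nonzero disjoint elements. -/
lemma LatticeEmbedding.modular_map_of_disj_of_disj
    (θ : LatticeEmbedding (NakanoSpace μ p hp) (NakanoSpace ν q hq)) {e₁ e₂ e₃ : NakanoSpace μ p hp}
    (h₁ : e₁ ≠ 0) (h₂ : e₂ ≠ 0) (h₃ : e₃ ≠ 0) (h₁₂ : Disj (e₁ : X →ₘ[μ] ℝ) e₂)
    (h₁₃ : Disj (e₁ : X →ₘ[μ] ℝ) e₃) (h₂₃ : Disj (e₂ : X →ₘ[μ] ℝ) e₃) :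
    modular μ p e₁ = modular ν q (θ.toLinearMap e₁) := by
  have hrel : ∀ s₁ s₂ s₃ : ℝ,
      modular μ p (s₁ • e₁ : NakanoSpace μ p hp) + modular μ p (s₂ • e₂ : NakanoSpace μ p hp)
        + modular μ p (s₃ • e₃ : NakanoSpace μ p hp) = 1 →
      modular ν q (θ.toLinearMap (s₁ • e₁)) + modular ν q (θ.toLinearMap (s₂ • e₂))
        + modular ν q (θ.toLinearMap (s₃ • e₃)) = 1 := by
    intro s₁ s₂ s₃ h
    have d₁ : Disj ((s₁ • e₁ : NakanoSpace μ p hp) : X →ₘ[μ] ℝ) (s₂ • e₂ : NakanoSpace μ p hp) :=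
      h₁₂.smul s₁ s₂
    have d₂ : Disj ((s₁ • e₁ + s₂ • e₂ : NakanoSpace μ p hp) : X →ₘ[μ] ℝ)
        (s₃ • e₃ : NakanoSpace μ p hp) := (h₁₃.smul s₁ s₃).add (h₂₃.smul s₂ s₃)
    rw [← θ.modular_map_add d₁, ← θ.modular_map_add d₂]
    refine θ.modular_map_eq_one ?_
    rw [← h, ← modular_add_of_disj hp d₁, ← Submodule.coe_add, ← modular_add_of_disj hp d₂,
      ← Submodule.coe_add]
  have hex : ∀ e : NakanoSpace μ p hp, e ≠ 0 → ∃ σ : ℝ → ℝ, ∀ a, 0 ≤ a →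
      modular μ p (σ a • e : NakanoSpace μ p hp) = ENNReal.ofReal a := fun e he => by
    choose! σ hσ using fun a (ha : 0 ≤ a) => exists_smul_modular_eq he ha
    exact ⟨σ, hσ⟩
  obtain ⟨σ₁, hσ₁⟩ := hex e₁ h₁
  obtain ⟨σ₂, hσ₂⟩ := hex e₂ h₂
  obtain ⟨σ₃, hσ₃⟩ := hex e₃ h₃
  have hzero : ∀ (e : NakanoSpace μ p hp) (σ : ℝ → ℝ),
      (∀ a, 0 ≤ a → modular μ p (σ a • e : NakanoSpace μ p hp) = ENNReal.ofReal a) →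
      (modular ν q (θ.toLinearMap (σ 0 • e))).toReal = 0 := by
    intro e σ hσ
    have h0 : σ 0 • e = 0 := Subtype.ext (modular_eq_zero hp (by simpa using hσ 0 le_rfl))
    rw [h0, map_zero, Submodule.coe_zero, modular_zero hq, ENNReal.toReal_zero]
  have htop : ∀ g : NakanoSpace ν q hq, modular ν q g ≠ ∞ := fun g => LT.lt.ne g.2
  have hrel' : ∀ s a b c : ℝ, 0 ≤ a → 0 ≤ b → 0 ≤ c → a + b + c = 1 →
      modular μ p (s • e₁ : NakanoSpace μ p hp) = ENNReal.ofReal a →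
      (modular ν q (θ.toLinearMap (s • e₁))).toReal
        + (modular ν q (θ.toLinearMap (σ₂ b • e₂))).toReal
        + (modular ν q (θ.toLinearMap (σ₃ c • e₃))).toReal = 1 := by
    intro s a b c ha hb hc habc hs
    rw [← ENNReal.toReal_add (htop _) (htop _),
      ← ENNReal.toReal_add (ENNReal.add_ne_top.2 ⟨htop _, htop _⟩) (htop _),
      hrel s (σ₂ b) (σ₃ c), ENNReal.toReal_one]
    rw [hs, hσ₂ b hb, hσ₃ c hc, ← ENNReal.ofReal_add ha hb, ← ENNReal.ofReal_add (by linarith) hc,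
      habc, ENNReal.ofReal_one]
  have hid : ∀ a, 0 ≤ a → a ≤ 1 → (modular ν q (θ.toLinearMap (σ₁ a • e₁))).toReal = a :=
    fun a ha ha1 => eq_self_of_add_add_eq_one
      (f := fun a => (modular ν q (θ.toLinearMap (σ₁ a • e₁))).toReal)
      (hzero e₁ σ₁ hσ₁) (hzero e₂ σ₂ hσ₂) (hzero e₃ σ₃ hσ₃) (fun _ => ENNReal.toReal_nonneg)
      (fun a b c ha hb hc habc => hrel' _ a b c ha hb hc habc (hσ₁ a ha)) ha ha1
  refine modular_eq_of_forall_expModular_le_one hp hq e₁.2 (θ.toLinearMap e₁).2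
    (fun h => h₁ (Subtype.ext h)) fun t ht => ?_
  have h0 := expModular_nonneg (μ := μ) (p := p) (e₁ : X →ₘ[μ] ℝ) t
  -- `σ₁` need not return `exp t`. Completing both multiples of `e₁` by the same multiple of `e₃`
  -- shows that their images have the same level.
  have h1 := hrel' (Real.exp t) (expModular μ p e₁ t) 0 (1 - expModular μ p e₁ t) h0 le_rfl
    (by linarith) (by ring) (ENNReal.ofReal_toReal (modular_smul_lt_top hp _ e₁.2).ne).symm
  have h2 := hrel' _ (expModular μ p e₁ t) 0 (1 - expModular μ p e₁ t) h0 le_rfl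
    (by linarith) (by ring) (hσ₁ _ h0)
  rw [hid _ h0 ht] at h2
  rw [θ.expModular_map]
  linarith

end disjoint

/-! ### Atoms, splitting, and the two-atom case. -/

section atoms

variable {X Y : Type*} [MeasurableSpace X] [MeasurableSpace Y] {μ : Measure X} {ν : Measure Y}
  {p : X → ℝ} {q : Y → ℝ} {hp : IsExponent μ p} {hq : IsExponent ν q}

lemma expModular_eq_exp_mul {f : X →ₘ[μ] ℝ} {c : ℝ} (hc : ∀ᵐ x ∂μ, f x ≠ 0 → p x = c)
    (hp : IsExponent μ p) (h1 : modular μ p f = 1) (t : ℝ) :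
    expModular μ p f t = Real.exp (c * t) := by
  have h : modular μ p (Real.exp t • f) = ENNReal.ofReal (Real.exp (c * t)) * modular μ p f := by
    unfold modular
    rw [← lintegral_const_mul' _ _ ENNReal.ofReal_ne_top]
    refine lintegral_congr_ae ?_
    filter_upwards [hc, AEEqFun.coeFn_smul (Real.exp t) f] with x hx h2
    rw [h2, Pi.smul_apply, smul_eq_mul, ← ENNReal.ofReal_mul (Real.exp_pos _).le]
    congr 1
    by_cases h0 : f x = 0
    · have h3 : p x ≠ 0 := (zero_lt_one.trans_le (hp.one_le x)).ne'
      simp [h0, Real.zero_rpow h3]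
    · rw [hx h0, abs_mul, Real.abs_exp, Real.mul_rpow (Real.exp_pos _).le (abs_nonneg _),
        ← Real.exp_mul, mul_comm t]
  rw [expModular, h, h1, mul_one, ENNReal.toReal_ofReal (Real.exp_pos _).le]

/-- An embedding respects the modular functional on the first of two disjoint nonzero elements
if the exponent is constant on the support of each of them. -/
lemma LatticeEmbedding.modular_map_of_exponent_const
    (θ : LatticeEmbedding (NakanoSpace μ p hp) (NakanoSpace ν q hq)) {e₁ e₂ : NakanoSpace μ p hp}
    (h₁ : e₁ ≠ 0) (h₂ : e₂ ≠ 0) (hd : Disj (e₁ : X →ₘ[μ] ℝ) e₂) {a b : ℝ} (ha : 1 ≤ a) (hb : 1 ≤ b)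
    (hpa : ∀ᵐ x ∂μ, (e₁ : X →ₘ[μ] ℝ) x ≠ 0 → p x = a)
    (hpb : ∀ᵐ x ∂μ, (e₂ : X →ₘ[μ] ℝ) x ≠ 0 → p x = b) :
    modular μ p e₁ = modular ν q (θ.toLinearMap e₁) := by
  have hnorm : ∀ e : NakanoSpace μ p hp, e ≠ 0 →
      ∃ t : ℝ, modular μ p (Real.exp t • e : NakanoSpace μ p hp) = 1 := by
    intro e he
    obtain ⟨t, ht⟩ := exists_expModular_eq hp e.2 (fun h => he (Subtype.ext h)) one_pos
    refine ⟨t, ?_⟩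
    rw [← ENNReal.ofReal_one, ← ht, expModular, Submodule.coe_smul,
      ENNReal.ofReal_toReal (modular_smul_lt_top hp _ e.2).ne]
  have hconst : ∀ (e : NakanoSpace μ p hp) (c t : ℝ),
      (∀ᵐ x ∂μ, (e : X →ₘ[μ] ℝ) x ≠ 0 → p x = c) → ∀ᵐ x ∂μ,
        ((Real.exp t • e : NakanoSpace μ p hp) : X →ₘ[μ] ℝ) x ≠ 0 → p x = c := by
    intro e c t h
    filter_upwards [h, AEEqFun.coeFn_smul (Real.exp t) (e : X →ₘ[μ] ℝ)] with x hx h2 h3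
    refine hx fun h0 => h3 ?_
    rw [Submodule.coe_smul, h2, Pi.smul_apply, h0, smul_zero]
  obtain ⟨t₁, ht₁⟩ := hnorm e₁ h₁
  obtain ⟨t₂, ht₂⟩ := hnorm e₂ h₂
  have hshift : ∀ (e : NakanoSpace μ p hp) (s t : ℝ),
      Real.exp s • Real.exp t • e = Real.exp (s + t) • e := by
    intro e s t
    rw [smul_smul, Real.exp_add]
  set f := Real.exp t₁ • e₁ with hf
  set g := Real.exp t₂ • e₂ with hg
  have hfg : ∀ s t, Real.exp (a * s) + Real.exp (b * t) = 1 →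
      expModular ν q (θ.toLinearMap f) s + expModular ν q (θ.toLinearMap g) t = 1 := by
    intro s t hst
    have hd' : Disj ((Real.exp s • f : NakanoSpace μ p hp) : X →ₘ[μ] ℝ)
        (Real.exp t • g : NakanoSpace μ p hp) := (hd.smul _ _).smul _ _
    have hone : modular μ p (Real.exp s • f + Real.exp t • g : NakanoSpace μ p hp) = 1 := by
      rw [Submodule.coe_add, modular_add_of_disj hp hd', ← ENNReal.ofReal_one, ← hst,
        ENNReal.ofReal_add (Real.exp_pos _).le (Real.exp_pos _).le,
        ← expModular_eq_exp_mul (hconst _ _ _ hpa) hp ht₁,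
        ← expModular_eq_exp_mul (hconst _ _ _ hpb) hp ht₂, expModular, expModular,
        ENNReal.ofReal_toReal (modular_smul_lt_top hp _ f.2).ne,
        ENNReal.ofReal_toReal (modular_smul_lt_top hp _ g.2).ne]
      rfl
    have h := θ.modular_map_eq_one hone
    rw [θ.modular_map_add hd'] at h
    rw [θ.expModular_map, θ.expModular_map, ← ENNReal.toReal_add
      (LT.lt.ne (θ.toLinearMap (Real.exp s • f)).2) (LT.lt.ne (θ.toLinearMap (Real.exp t • g)).2), h, ENNReal.toReal_one]
  obtain ⟨r, hr⟩ := hq.ess_bounded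
  -- One constant serves both atoms because their exponents are at least 1.
  have hbound : ∀ c : ℝ, 1 ≤ c → ∀ᵐ y ∂ν, q y ≤ max r 1 * c := by
    intro c hc
    filter_upwards [hr] with y hy
    nlinarith [le_max_left r 1, le_max_right r 1]
  have hθf := θ.modular_map_eq_one ht₁
  have hθg := θ.modular_map_eq_one ht₂
  have key : ∀ s < 0, expModular ν q (θ.toLinearMap f) s = Real.exp (a * s) := fun s hs =>
    eq_exp_of_add_eq_one (by linarith) (by linarith) (expModular_nonneg _) (expModular_nonneg _)
      (sq_expModular_le hq hθf) (sq_expModular_le hq hθg)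
      (fun s hs => one_sub_mul_le_expModular hq hθf (le_max_right r 1) (hbound a ha) hs)
      (fun s hs => one_sub_mul_le_expModular hq hθg (le_max_right r 1) (hbound b hb) hs) hfg hs
  have h₁' : (e₁ : X →ₘ[μ] ℝ) ≠ 0 := fun h => h₁ (Subtype.ext h)
  refine modular_eq_of_forall_expModular_le_one hp hq e₁.2 (θ.toLinearMap e₁).2 h₁' fun t ht => ?_
  have ht₁' : expModular μ p e₁ t₁ = 1 := by
    rw [expModular, ← Submodule.coe_smul, ← hf, ht₁, ENNReal.toReal_one]
  have hle : t ≤ t₁ := by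
    rwa [← ht₁', (expModular_strictMono hp e₁.2 h₁').le_iff_le] at ht
  rcases hle.eq_or_lt with rfl | hlt
  -- The level is exactly 1 here; `key` covers only strictly negative shifts.
  · rw [ht₁', θ.expModular_map, ← hf, hθf, ENNReal.toReal_one]
  · have h3 := key (t - t₁) (by linarith)
    rw [← expModular_eq_exp_mul (hconst _ _ _ hpa) hp ht₁, θ.expModular_map, hf, hshift,
      sub_add_cancel, expModular, ← Submodule.coe_smul, hshift, sub_add_cancel,
      Submodule.coe_smul] at h3
    rw [θ.expModular_map, h3, expModular]

/-- An element `f` is atomic if no measurable set splits its support in a nontrivial way. -/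
def Atomic (f : X →ₘ[μ] ℝ) : Prop :=
  ∀ U, MeasurableSet U → (∀ᵐ x ∂μ, f x ≠ 0 → x ∈ U) ∨ (∀ᵐ x ∂μ, f x ≠ 0 → x ∉ U)

/-- On the support every preimage under `w` of a measurable set is null or conull, and countably
many measurable sets separate the points of `ℝ`. -/
lemma Atomic.exists_const {f : X →ₘ[μ] ℝ} (hf : Atomic f) {w : X → ℝ} (hw : Measurable w) :
    ∃ c, ∀ᵐ x ∂μ, f x ≠ 0 → w x = c := by
  have hm : MeasurableSet {x | f x ≠ 0} := f.measurable (measurableSet_singleton 0).compl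
  obtain ⟨c, hc⟩ := Filter.exists_eventuallyEq_const_of_forall_separating
    (l := ae (μ.restrict {x | f x ≠ 0})) (f := w) MeasurableSet fun U hU => by
      have := hf (w ⁻¹' U) (hw hU)
      rwa [ae_restrict_iff' hm, ae_restrict_iff' hm]
  exact ⟨c, (ae_restrict_iff' hm).1 hc⟩

/-- The pieces are the restrictions of `f` to a splitting set and to its complement; both lie in the
space because they are dominated by `f`. -/
lemma exists_add_of_not_atomic {f : NakanoSpace μ p hp} (hf : ¬ Atomic (f : X →ₘ[μ] ℝ)) :
    ∃ f₁ f₂ : NakanoSpace μ p hp, f₁ ≠ 0 ∧ f₂ ≠ 0 ∧ f = f₁ + f₂ ∧ Disj (f₁ : X →ₘ[μ] ℝ) f₂ ∧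
      ∀ g : X →ₘ[μ] ℝ, Disj (f : X →ₘ[μ] ℝ) g →
        Disj (f₁ : X →ₘ[μ] ℝ) g ∧ Disj (f₂ : X →ₘ[μ] ℝ) g := by
  unfold Atomic at hf
  push Not at hf
  obtain ⟨U, hU, hn₁, hn₂⟩ := hf
  have hpart : ∀ V, MeasurableSet V → ∃ u : NakanoSpace μ p hp,
      (u : X →ₘ[μ] ℝ) =ᵐ[μ] V.indicator (f : X →ₘ[μ] ℝ) := by
    intro V hV
    have hs := ((f : X →ₘ[μ] ℝ).stronglyMeasurable.indicator hV).aestronglyMeasurable (μ := μ)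
    have hae := AEEqFun.coeFn_mk _ hs
    refine ⟨⟨AEEqFun.mk _ hs, (modular_mono hp ?_).trans_lt f.2⟩, hae⟩
    filter_upwards [hae] with x hx
    rw [hx]
    by_cases h : x ∈ V <;> simp [h]
  obtain ⟨f₁, hf₁⟩ := hpart U hU
  obtain ⟨f₂, hf₂⟩ := hpart Uᶜ hU.compl
  have hz := AEEqFun.coeFn_zero (α := X) (μ := μ) (β := ℝ)
  refine ⟨f₁, f₂, ?_, ?_, ?_, ?_, fun g hg => ⟨?_, ?_⟩⟩
  · rintro rfl
    refine hn₂ ?_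
    filter_upwards [hf₁, hz] with x h1 h2 ⟨h3, h4⟩
    rw [Submodule.coe_zero, h2, Set.indicator_of_mem h4] at h1
    exact h3 h1.symm
  · rintro rfl
    refine hn₁ ?_
    filter_upwards [hf₂, hz] with x h1 h2 ⟨h3, h4⟩
    rw [Submodule.coe_zero, h2, Set.indicator_of_mem (Set.mem_compl h4)] at h1
    exact h3 h1.symm
  · refine Subtype.ext (AEEqFun.ext ?_)
    filter_upwards [hf₁, hf₂, AEEqFun.coeFn_add (f₁ : X →ₘ[μ] ℝ) (f₂ : X →ₘ[μ] ℝ)] with x h1 h2 h3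
    rw [Submodule.coe_add, h3, Pi.add_apply, h1, h2]
    by_cases h : x ∈ U <;> simp [h]
  · filter_upwards [hf₁, hf₂] with x h1 h2
    rw [h1, h2]
    by_cases h : x ∈ U <;> simp [h]
  · filter_upwards [hf₁, hg] with x h1 h2
    rw [h1]
    by_cases h : x ∈ U <;> simp [h, h2]
  · filter_upwards [hf₂, hg] with x h1 h2
    rw [h1]
    by_cases h : x ∈ U <;> simp [h, h2]

lemma Atomic.exists_exponent_eq (hp : IsExponent μ p) {f : X →ₘ[μ] ℝ} (hf : Atomic f) :
    ∃ c, 1 ≤ c ∧ ∀ᵐ x ∂μ, f x ≠ 0 → p x = c := by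
  obtain ⟨c, hc⟩ := hf.exists_const hp.measurable
  -- If `f = 0`, then `c` is arbitrary and could lie below 1; otherwise the maximum changes nothing.
  refine ⟨max c 1, le_max_right _ _, ?_⟩
  filter_upwards [hc] with x hx h
  rw [← hx h, max_eq_left (hp.one_le x)]

/-- An embedding respects the modular functional on an element that is disjoint from some nonzero
element. -/
lemma LatticeEmbedding.modular_map_of_disj
    (θ : LatticeEmbedding (NakanoSpace μ p hp) (NakanoSpace ν q hq)) {f g : NakanoSpace μ p hp}
    (hf : f ≠ 0) (hg : g ≠ 0) (hd : Disj (f : X →ₘ[μ] ℝ) g) :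
    modular μ p f = modular ν q (θ.toLinearMap f) := by
  by_cases haf : Atomic (f : X →ₘ[μ] ℝ)
  · by_cases hag : Atomic (g : X →ₘ[μ] ℝ)
    · obtain ⟨a, ha, hpa⟩ := haf.exists_exponent_eq hp
      obtain ⟨b, hb, hpb⟩ := hag.exists_exponent_eq hp
      exact θ.modular_map_of_exponent_const hf hg hd ha hb hpa hpb
    · obtain ⟨g₁, g₂, h₁, h₂, -, h₁₂, h⟩ := exists_add_of_not_atomic hag
      have := h _ hd.symm
      exact θ.modular_map_of_disj_of_disj hf h₁ h₂ this.1.symm this.2.symm h₁₂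
  · obtain ⟨f₁, f₂, h₁, h₂, rfl, h₁₂, h⟩ := exists_add_of_not_atomic haf
    have := h _ hd
    rw [Submodule.coe_add, modular_add_of_disj hp h₁₂,
      θ.modular_map_add h₁₂,
      θ.modular_map_of_disj_of_disj h₁ h₂ hg h₁₂ this.1 this.2,
      θ.modular_map_of_disj_of_disj h₂ h₁ hg h₁₂.symm this.2 this.1]

/-- If an atomic element is disjoint from no nonzero element, it spans the Nakano space. -/
lemma Atomic.rank_le_one {f : NakanoSpace μ p hp} (hf : Atomic (f : X →ₘ[μ] ℝ))
    (h : ∀ g : NakanoSpace μ p hp, Disj (f : X →ₘ[μ] ℝ) g → g = 0) :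
    Module.rank ℝ (NakanoSpace μ p hp) ≤ 1 := by
  refine rank_le_one_iff.2 ⟨f, fun g => ?_⟩
  -- The quotient `g / f` is constant on the support of `f`, so `g - c • f` is disjoint from `f` and
  -- must vanish.
  obtain ⟨c, hc⟩ := hf.exists_const
    ((g : X →ₘ[μ] ℝ).measurable.div (f : X →ₘ[μ] ℝ).measurable)
  refine ⟨c, (sub_eq_zero.1 (h (g - c • f) ?_)).symm⟩
  filter_upwards [hc, AEEqFun.coeFn_sub (g : X →ₘ[μ] ℝ) (c • (f : X →ₘ[μ] ℝ)),
    AEEqFun.coeFn_smul c (f : X →ₘ[μ] ℝ)] with x h1 h2 h3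
  refine or_iff_not_imp_left.2 fun h0 => ?_
  have h4 := h1 h0
  rw [Pi.div_apply, div_eq_iff h0] at h4
  rw [Submodule.coe_sub, Submodule.coe_smul, h2, Pi.sub_apply, h3, Pi.smul_apply, h4,
    smul_eq_mul, sub_self]

end atoms

end Nakano

/-! ### Conclusion from the dimension hypothesis. -/

theorem corollary1p11 {X Y : Type*} [MeasurableSpace X] [MeasurableSpace Y]
    (μ : MeasureTheory.Measure X) (ν : MeasureTheory.Measure Y)
    (hμ : Nakano.StrictlyLocalisable μ) (hν : Nakano.StrictlyLocalisable ν)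
    (p : X → ℝ) (q : Y → ℝ) (hp : Nakano.IsExponent μ p) (hq : Nakano.IsExponent ν q)
    (hdim : 2 ≤ Module.rank ℝ (Nakano.NakanoSpace μ p hp))
    (θ : Nakano.LatticeEmbedding (Nakano.NakanoSpace μ p hp) (Nakano.NakanoSpace ν q hq))
    (f : Nakano.NakanoSpace μ p hp) :
    Nakano.modular μ p (f : X →ₘ[μ] ℝ)
      = Nakano.modular ν q (θ.toLinearMap f : Y →ₘ[ν] ℝ) := by
  by_cases hf : f = 0
  · subst hf
    rw [map_zero, Submodule.coe_zero, Submodule.coe_zero, Nakano.modular_zero hp,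
      Nakano.modular_zero hq]
  by_cases hg : ∃ g : Nakano.NakanoSpace μ p hp, g ≠ 0 ∧ Nakano.Disj (f : X →ₘ[μ] ℝ) g
  · obtain ⟨g, hg, hd⟩ := hg
    exact θ.modular_map_of_disj hf hg hd
  -- With no nonzero element disjoint from `f`, an atomic `f` would span the whole space.
  have hatom : ¬ Nakano.Atomic (f : X →ₘ[μ] ℝ) := fun ha =>
    absurd (hdim.trans (ha.rank_le_one fun g hd => by_contra fun h => hg ⟨g, h, hd⟩))
      (not_le.2 Cardinal.one_lt_two)
  obtain ⟨f₁, f₂, h₁, h₂, rfl, h₁₂, -⟩ := Nakano.exists_add_of_not_atomic hatom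
  rw [Submodule.coe_add, Nakano.modular_add_of_disj hp h₁₂,
    θ.modular_map_add h₁₂, θ.modular_map_of_disj h₁ h₂ h₁₂, θ.modular_map_of_disj h₂ h₁ h₁₂.symm]
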